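/- Let $D$ be a connected planar diagram of an oriented link $L$ with $\mu(L)$ components, let $v_1,\dots,v_n$ ($n\ge 0$) be its double points, and choose any two distinct adjacent regions of $D$ (regions that share an edge) and mark each of them with a star. An FKT state $S$ of $D$ is an assignment, to each double point $v_i$, of a marker placed in one of the four corners at $v_i$, lying in an unstarred region, such that no region contains more than one marker. A marker is a black hole if its corner lies between the two lines going into the double point, and a white hole if its corner lies between the two lines going out of it; let $\sharp B_S$ and $\sharp W_S$ be the numbers of black holes and of white holes of $S$. Then, for every FKT state $S$ of $D$, the numbers $\sharp B_S$ and $\sharp W_S$ have the same parity if $\mu(L)$ is odd, and opposite parity if $\mu(L)$ is even; that is, $$\sharp B_S+\sharp W_S\equiv \mu(L)+1 \pmod 2 .$$ -/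

import Mathlib

/-- The line-ends of a diagram whose double points are indexed by `C` and which has in addition
some bends indexed by `B` (marked points where two line-ends meet, so that a simple closed curve
without double points can be drawn as well). Four line-ends meet at each double point `c`: they are
`(c, 0)`, `(c, 1)`, `(c, 2)`, `(c, 3)` in counterclockwise order. Two line-ends meet at each
bend. -/
abbrev LineEnd (C B : Type*) : Type _ := (C × ZMod 4) ⊕ (B × ZMod 2)

namespace LineEnd

/-- The next line-end counterclockwise around the same vertex. -/
def rot {C B : Type*} : LineEnd C B → LineEnd C B
  | Sum.inl (c, k) => Sum.inl (c, k + 1)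
  | Sum.inr (b, k) => Sum.inr (b, k + 1)

/-- The line-end at the same vertex that belongs to the same strand: a strand goes straight across
each double point. -/
def opp {C B : Type*} : LineEnd C B → LineEnd C B
  | Sum.inl (c, k) => Sum.inl (c, k + 2)
  | Sum.inr (b, k) => Sum.inr (b, k + 1)

end LineEnd

/-- An oriented link diagram, as a combinatorial map on closed oriented surfaces (planarity is the
predicate `IsPlanar` below): the vertices are the double points `C` and the bends `B`, with the
cyclic order `LineEnd.rot` of line-ends around each of them. -/
structure OrientedLinkDiagram (C B : Type*) where
  /-- `arc e` is the other end of the edge which starts with the line-end `e`. -/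
  arc : LineEnd C B → LineEnd C B
  arc_arc : ∀ e, arc (arc e) = e
  /-- `ingoing e`: along `e` the orientation of the link points towards the vertex of `e`;
  otherwise it points away from that vertex. -/
  ingoing : LineEnd C B → Prop
  /-- Each edge leaves one of its ends and enters at the other one. In particular the two ends of
  an edge are distinct. -/
  ingoing_arc : ∀ e, ingoing (arc e) ↔ ¬ ingoing e
  /-- A strand which enters a vertex leaves it on the opposite side. -/
  ingoing_opp : ∀ e, ingoing (LineEnd.opp e) ↔ ¬ ingoing e
  /-- Crossing information: whether the strand through the line-ends `0` and `2` of a double point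
  is the upper one there (otherwise it is the strand through `1` and `3`). -/
  evenOver : C → Bool

namespace OrientedLinkDiagram

variable {C B : Type*} (D : OrientedLinkDiagram C B)

/-- The edges: a line-end is identified with the other end of its edge. -/
def Edge : Type _ := Quot (fun e e' : LineEnd C B => e' = D.arc e)

/-- The components of the link: line-ends are identified when they are the two ends of one edge, or
belong to the same strand across a vertex. -/
def LinkComponent : Type _ :=
  Quot (fun e e' : LineEnd C B => e' = D.arc e ∨ e' = LineEnd.opp e)

/-- The number `μ` of components of the link. -/
noncomputable def numComponents : ℕ := Nat.card D.LinkComponent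

/-- The connected pieces of the diagram, as a subset of the surface. -/
def Piece : Type _ :=
  Quot (fun e e' : LineEnd C B => e' = D.arc e ∨ e' = LineEnd.rot e)

/-- The diagram is connected (and nonempty). -/
def IsConnected : Prop := Nonempty D.Piece ∧ Subsingleton D.Piece

/-- The regions of a connected diagram, as classes of corners. A line-end `e` also stands for the
corner between `e` and the next line-end `rot e` counterclockwise, that is, the corner to the left
of someone who walks away from the vertex along `e`. Such a walk ends at the line-end `arc e`, with
the corner between `e'` and `rot e' = arc e` on the left, so this is the next corner of the
region. -/
def Region : Type _ := Quot (fun e e' : LineEnd C B => LineEnd.rot e' = D.arc e)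

/-- The region that contains the corner between `e` and `rot e`. -/
def region (e : LineEnd C B) : D.Region := Quot.mk _ e

/-- The diagram is planar: every piece has genus zero, by Euler's formula
`#vertices - #edges + #regions = 2` summed over the pieces. -/
def IsPlanar : Prop :=
  (Nat.card (C ⊕ B) : ℤ) - Nat.card D.Edge + Nat.card D.Region = 2 * Nat.card D.Piece

/-- Two different regions are adjacent if some edge has one of them on its left and the other one
on its right: the line-end `rot e` has the corner `rot e` on one side and `e` on the other. -/
def Adjacent (R₁ R₂ : D.Region) : Prop :=
  R₁ ≠ R₂ ∧ ∃ e : LineEnd C B, R₁ = D.region (LineEnd.rot e) ∧ R₂ = D.region e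

/-- An FKT state for the choice of `R₁` and `R₂` as the starred regions: each double point gets a
marker in one of its four corners, in an unstarred region, and no region contains more than one
marker. The corner `k` at `c` is the one between the line-ends `(c, k)` and `(c, k + 1)`. -/
structure FKTState (R₁ R₂ : D.Region) where
  marker : C → ZMod 4
  unstarred : ∀ c, D.region (Sum.inl (c, marker c)) ≠ R₁ ∧ D.region (Sum.inl (c, marker c)) ≠ R₂
  injective : Function.Injective fun c => D.region (Sum.inl (c, marker c))

namespace FKTState

variable {D} {R₁ R₂ : D.Region} (S : D.FKTState R₁ R₂)

/-- The double points whose marker is a black hole: it lies between two ingoing lines. -/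
def blackHoles : Set C :=
  {c | D.ingoing (Sum.inl (c, S.marker c)) ∧ D.ingoing (Sum.inl (c, S.marker c + 1))}

/-- The double points whose marker is a white hole: it lies between two outgoing lines. -/
def whiteHoles : Set C :=
  {c | ¬ D.ingoing (Sum.inl (c, S.marker c)) ∧ ¬ D.ingoing (Sum.inl (c, S.marker c + 1))}

end FKTState

end OrientedLinkDiagram

/-! Everything is a count of circles modulo two. Let `n` be the number of double points, `μ` the
number of components, `s` the number of Seifert circles (all double points smoothed along the
orientation) and `b` the number of black regions of a checkerboard colouring.

Changing how the strands are joined at one double point should change the number of circles by one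
modulo two, provided that both ways of joining reverse a common two-valued label.
`card_quot_add_card_quot_modEq` proves this with permutation signs: the circles are the orbits of a
permutation of half of the line-ends, and the sign of a permutation determines the parity of its
number of orbits. Passing from the link to the Seifert circles (label: orientation) gives `μ + s ≡
n`. Passing from the Seifert circles to the boundaries of the black regions (label: colour) gives `s
+ b ≡ d`, where `d` counts the double points at which the two smoothings differ.

The colouring exists because the sum of all edges is a mod 2 cycle and, by Euler's formula and
connectedness, cycles bound (`IsPlanar.exists_checkerboard`). There are `n + 2` regions, so the
markers fill all unstarred ones. Exactly one of the adjacent starred regions is black, hence `b` is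
one more than the number of markers in black regions. Finally, whether the two smoothings differ at
a double point is decided by whether its marker is a hole and whether it lies in a black region;
summing over the double points relates `d` to the number of holes. -/

/-! ### Permutation signs and orbit counts -/

/-- The parity of a permutation is that of the number of points plus the number of orbits. -/
theorem Equiv.Perm.sign_eq_neg_one_pow_card_add_card_orbits {X : Type*} [Fintype X] [DecidableEq X]
    (f : Equiv.Perm X) :
    Equiv.Perm.sign f = (-1) ^ (Nat.card X + Nat.card (Quot fun x y => y = f x)) := by
  classical
  have hzpow : ∀ (i : ℤ) (x : X),
      Quot.mk (fun x y => y = f x) ((f ^ i) x) = Quot.mk (fun x y => y = f x) x := by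
    intro i
    induction i with
    | zero => intro x; rfl
    | succ i ih =>
      intro x
      rw [zpow_add, zpow_one, Equiv.Perm.mul_apply, ih]
      exact (Quot.sound (r := fun x y => y = f x) rfl).symm
    | pred i ih =>
      intro x
      rw [zpow_sub, zpow_one, Equiv.Perm.mul_apply, ih]
      exact Quot.sound (by simp)
  -- An orbit is either a fixed point or the support of a cycle factor.
  let F : (Quot fun x y => y = f x) → {x // x ∉ f.support} ⊕ f.cycleFactorsFinset :=
    Quot.lift (fun x => if h : x ∈ f.support
        then Sum.inr ⟨f.cycleOf x, Equiv.Perm.cycleOf_mem_cycleFactorsFinset_iff.2 h⟩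
        else Sum.inl ⟨x, h⟩) (by
      rintro x _ rfl
      by_cases h : x ∈ f.support
      · have h' : f x ∈ f.support := Equiv.Perm.apply_mem_support.2 h
        simp only [h, h', dif_pos]
        congr 2
        exact (Equiv.Perm.SameCycle.cycleOf_eq
          (Equiv.Perm.sameCycle_apply_right.2 (Equiv.Perm.SameCycle.refl f x)))
      · have h' : f x = x := by simpa using h
        simp only [h'])
  have hF : Function.Bijective F := by
    constructor
    · rintro ⟨x⟩ ⟨y⟩ hxy
      by_cases hx : x ∈ f.support <;> by_cases hy : y ∈ f.support <;>
        simp only [F, hx, hy, dif_pos, dif_neg, not_false_eq_true, reduceCtorEq, Sum.inr.injEq,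
          Sum.inl.injEq, Subtype.mk.injEq] at hxy
      · have : f.SameCycle x y := by
          have h1 : f.cycleOf x y ≠ y := by
            rw [hxy, Equiv.Perm.cycleOf_apply_self]
            exact Equiv.Perm.mem_support.1 hy
          by_contra h2
          exact h1 (Equiv.Perm.cycleOf_apply_of_not_sameCycle h2)
        obtain ⟨i, rfl⟩ := this
        exact (hzpow i x).symm
      · rw [hxy]
    · rintro (⟨x, hx⟩ | ⟨c, hc⟩)
      · exact ⟨Quot.mk _ x, by simp only [F, hx, dif_neg, not_false_eq_true]⟩
      · obtain ⟨x, hx⟩ := (Equiv.Perm.mem_cycleFactorsFinset_iff.1 hc).1.nonempty_support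
        have hxf : x ∈ f.support := Equiv.Perm.mem_cycleFactorsFinset_support_le hc hx
        refine ⟨Quot.mk _ x, ?_⟩
        simp only [F, hxf, dif_pos]
        congr 2
        exact ((Equiv.Perm.cycle_is_cycleOf hx hc)).symm
  have hcard := Nat.card_eq_of_bijective F hF
  have hsupp : f.support.card + Nat.card {x // x ∉ f.support} = Nat.card X := by
    rw [Nat.card_eq_fintype_card, Nat.card_eq_fintype_card, Fintype.card_subtype_compl,
      Fintype.card_coe]
    have := Finset.card_le_univ f.support
    omega
  have hcyc : Multiset.card f.cycleType = Nat.card f.cycleFactorsFinset := by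
    rw [Nat.card_eq_fintype_card, Fintype.card_coe, Equiv.Perm.cycleType_def]
    simp
  rw [Nat.card_sum, ← hcyc] at hcard
  rw [Equiv.Perm.sign_of_cycleType, Equiv.Perm.sum_cycleType, neg_one_pow_congr]
  rw [hcard, ← hsupp, Nat.even_iff, Nat.even_iff]
  omega

section Orbits

variable {E : Type*}

/-- The equivalence on a `P`-set given by two permutations that both exchange `P` and its
complement. -/
def permOfFlip (P : E → Prop) (a s : E → E) (ha : ∀ e, a (a e) = e) (hs : ∀ e, s (s e) = e)
    (haP : ∀ e, P (a e) ↔ ¬ P e) (hsP : ∀ e, P (s e) ↔ ¬ P e) : Equiv.Perm {e // P e} where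
  toFun e := ⟨s (a e), by rw [hsP, haP, not_not]; exact e.2⟩
  invFun e := ⟨a (s e), by rw [haP, hsP, not_not]; exact e.2⟩
  left_inv e := by simp [ha, hs]
  right_inv e := by simp [ha, hs]

variable {P : E → Prop} {a s : E → E} (ha : ∀ e, a (a e) = e) (hs : ∀ e, s (s e) = e)
    (haP : ∀ e, P (a e) ↔ ¬ P e) (hsP : ∀ e, P (s e) ↔ ¬ P e)

/-- The classes generated by two involutions that exchange `P` and its complement are the orbits of
their composition on `P`. -/
theorem card_quot_eq_card_orbits_permOfFlip :
    Nat.card (Quot fun e e' : E => e' = a e ∨ e' = s e) =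
      Nat.card (Quot fun x y => y = permOfFlip P a s ha hs haP hsP x) := by
  classical
  -- Each class meets `P`: an element outside it is moved into it by `s`, within its class.
  let r : E → {e // P e} := fun e => if h : P e then ⟨e, h⟩ else ⟨s e, (hsP e).2 h⟩
  let F : (Quot fun e e' : E => e' = a e ∨ e' = s e) →
      Quot fun x y => y = permOfFlip P a s ha hs haP hsP x :=
    Quot.lift (fun e => Quot.mk _ (r e)) (by
      rintro e _ (rfl | rfl)
      · by_cases h : P e
        · exact Quot.sound (Subtype.ext (by simp [r, h, haP, permOfFlip]))
        · exact (Quot.sound (r := fun x y => y = permOfFlip P a s ha hs haP hsP x)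
            (Subtype.ext (by simp [r, h, haP, permOfFlip, ha]))).symm
      · congr 1
        by_cases h : P e
        · simp [r, h, hsP, hs]
        · simp [r, h, hsP])
  let G : (Quot fun x y => y = permOfFlip P a s ha hs haP hsP x) →
      Quot fun e e' : E => e' = a e ∨ e' = s e :=
    Quot.lift (fun e => Quot.mk _ e.1) (by
      rintro e _ rfl
      exact (Quot.sound (r := fun e e' : E => e' = a e ∨ e' = s e) (Or.inl rfl)).trans
        (Quot.sound (Or.inr rfl)))
  refine Nat.card_congr ⟨F, G, ?_, ?_⟩
  · rintro ⟨e⟩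
    by_cases h : P e
    · simp [F, G, r, h]
    · simp only [F, G, r, h, dif_neg, not_false_eq_true]
      exact (Quot.sound (r := fun e e' : E => e' = a e ∨ e' = s e) (Or.inr rfl)).symm
  · rintro ⟨e, h⟩
    simp [F, G, r, h]

/-- If `s` and `s'` are commuting involutions which disagree at `4 m` elements, then
replacing one of them by the other changes the number of classes by `m` modulo two. -/
theorem card_quot_add_card_quot_modEq [Finite E] {s' : E → E} (hs' : ∀ e, s' (s' e) = e)
    (hs'P : ∀ e, P (s' e) ↔ ¬ P e) (hcomm : ∀ e, s (s' e) = s' (s e)) {m : ℕ}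
    (hm : Nat.card {e // s e ≠ s' e} = 4 * m) (ha : ∀ e, a (a e) = e) (hs : ∀ e, s (s e) = e)
    (haP : ∀ e, P (a e) ↔ ¬ P e) (hsP : ∀ e, P (s e) ↔ ¬ P e) :
    Nat.card (Quot fun e e' : E => e' = a e ∨ e' = s e) +
      Nat.card (Quot fun e e' : E => e' = a e ∨ e' = s' e) ≡ m [MOD 2] := by
  classical
  have := Fintype.ofFinite E
  rw [card_quot_eq_card_orbits_permOfFlip ha hs haP hsP,
    card_quot_eq_card_orbits_permOfFlip ha hs' haP hs'P]
  set f := permOfFlip P a s ha hs haP hsP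
  set f' := permOfFlip P a s' ha hs' haP hs'P
  -- The involution `a` cancels, so only the comparison of `s` with `s'` remains.
  have hval : ∀ x : {e // P e}, ((f * f'⁻¹) x : E) = s (s' x) := by
    intro x
    change s (a (a (s' x))) = _
    rw [ha]
  have hfix : ∀ x : {e // P e}, (f * f'⁻¹) x = x ↔ s x = s' x := by
    intro x
    rw [Subtype.ext_iff, hval]
    constructor
    · intro h; rw [← h, hs, h]
    · intro h; rw [← h, hs]
  have hsq : (f * f'⁻¹) ^ 2 = 1 := by
    ext x
    rw [pow_two, Equiv.Perm.mul_apply, hval, hval, ← hcomm, hs', hs]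
    rfl
  -- `s` preserves the set of disagreement and exchanges `P` with its complement, so half of the `4
  -- * m` elements lie in `P`. They form `m` transpositions of `f * f'⁻¹`.
  have hhalf : Nat.card {x : {e // P e} // s x ≠ s' x} = 2 * m := by
    have h1 : Nat.card {e // s e ≠ s' e} =
        Nat.card {x : {e // P e} // s x ≠ s' x} + Nat.card {x : {e // ¬ P e} // s x ≠ s' x} := by
      rw [← Nat.card_sum]
      refine Nat.card_congr ⟨fun e => if h : P e then Sum.inl ⟨⟨e, h⟩, e.2⟩ else
        Sum.inr ⟨⟨e, h⟩, e.2⟩, Sum.elim (fun x => ⟨x.1.1, x.2⟩) (fun x => ⟨x.1.1, x.2⟩), ?_, ?_⟩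
      · intro e
        by_cases h : P e <;> simp [h]
      · rintro (⟨⟨x, h⟩, h'⟩ | ⟨⟨x, h⟩, h'⟩) <;> simp [h]
    have hne : ∀ e, s e ≠ s' e → s (s e) ≠ s' (s e) := by
      intro e h h'
      rw [← hcomm] at h'
      apply h
      rw [← hs (s e), h', hs]
    have h2 : Nat.card {x : {e // P e} // s x ≠ s' x} =
        Nat.card {x : {e // ¬ P e} // s x ≠ s' x} :=
      Nat.card_congr ⟨fun x => ⟨⟨s x.1, by rw [hsP, not_not]; exact x.1.2⟩, hne _ x.2⟩,
        fun x => ⟨⟨s x.1, by rw [hsP]; exact x.1.2⟩, hne _ x.2⟩,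
        fun x => by simp [hs], fun x => by simp [hs]⟩
    omega
  have hsign : Equiv.Perm.sign (f * f'⁻¹) = (-1) ^ m := by
    rw [Equiv.Perm.sign_of_pow_two_eq_one hsq]
    congr 1
    have h1 : Fintype.card (Function.fixedPoints (f * f'⁻¹)) =
        Fintype.card {x : {e // P e} // s x = s' x} :=
      Fintype.card_congr (Equiv.subtypeEquivRight hfix)
    have h2 := Fintype.card_subtype_compl fun x : {e // P e} => s x = s' x
    rw [Nat.card_eq_fintype_card] at hhalf
    rw [h1, ← h2]
    have : Fintype.card {x : {e // P e} // ¬ s x = s' x} = 2 * m := by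
      rw [← hhalf]
    omega
  rw [map_mul, map_inv, Equiv.Perm.sign_eq_neg_one_pow_card_add_card_orbits,
    Equiv.Perm.sign_eq_neg_one_pow_card_add_card_orbits, Int.units_inv_eq_self, ← pow_add] at hsign
  have h3 := congrArg (fun u : ℤˣ => u = 1) hsign
  simp only [eq_iff_iff, neg_one_pow_eq_one_iff_even (show (-1 : ℤˣ) ≠ 1 by decide),
    Nat.even_iff] at h3
  rw [Nat.ModEq]
  omega

end Orbits

/-! ### Line-ends and their vertices -/

namespace LineEnd

variable {C B : Type*}

/-- `LineEnd.rot` as a permutation. -/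
def rotEquiv : LineEnd C B ≃ LineEnd C B where
  toFun := rot
  invFun
    | Sum.inl (c, k) => Sum.inl (c, k - 1)
    | Sum.inr (b, k) => Sum.inr (b, k - 1)
  left_inv := by rintro (⟨c, k⟩ | ⟨b, k⟩) <;> simp [rot]
  right_inv := by rintro (⟨c, k⟩ | ⟨b, k⟩) <;> simp [rot]

@[simp] theorem rotEquiv_apply (e : LineEnd C B) : rotEquiv e = rot e := rfl

@[simp] theorem rot_rotEquiv_symm (e : LineEnd C B) : rot (rotEquiv.symm e) = e :=
  rotEquiv.apply_symm_apply e

@[simp] theorem rotEquiv_symm_rot (e : LineEnd C B) : rotEquiv.symm (rot e) = e :=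
  rotEquiv.symm_apply_apply e

@[simp] theorem opp_opp (e : LineEnd C B) : opp (opp e) = e := by
  rcases e with ⟨c, k⟩ | ⟨b, k⟩
  · have : (2 : ZMod 4) + 2 = 0 := by decide
    simp [opp, add_assoc, this]
  · have : (1 : ZMod 2) + 1 = 0 := by decide
    simp [opp, add_assoc, this]

theorem opp_inl (c : C) (k : ZMod 4) : opp (Sum.inl (c, k) : LineEnd C B) = Sum.inl (c, k + 2) :=
  rfl

theorem rot_inl (c : C) (k : ZMod 4) : rot (Sum.inl (c, k) : LineEnd C B) = Sum.inl (c, k + 1) :=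
  rfl

theorem opp_inr (b : B) (k : ZMod 2) : opp (Sum.inr (b, k) : LineEnd C B) = rot (Sum.inr (b, k)) :=
  rfl

theorem rotEquiv_symm_inr (b : B) (k : ZMod 2) :
    rotEquiv.symm (Sum.inr (b, k) : LineEnd C B) = rot (Sum.inr (b, k)) := by
  rw [Equiv.symm_apply_eq, rotEquiv_apply, ← opp_inr]
  exact (opp_opp _).symm

theorem rot_rot_inl (c : C) (k : ZMod 4) :
    rot (rot (Sum.inl (c, k) : LineEnd C B)) = opp (Sum.inl (c, k)) := by
  have : (1 : ZMod 4) + 1 = 2 := by decide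
  simp [rot, opp, add_assoc, this]

theorem opp_rotEquiv_symm_inl (c : C) (k : ZMod 4) :
    opp (rotEquiv.symm (Sum.inl (c, k) : LineEnd C B)) = rot (Sum.inl (c, k)) := by
  change opp (Sum.inl (c, k - 1)) = _
  rw [← rot_rot_inl]
  change rot (rot (rotEquiv.symm (Sum.inl (c, k)))) = _
  rw [rot_rotEquiv_symm]

/-- The vertex of a line-end. -/
def vertex : LineEnd C B → C ⊕ B := Sum.map Prod.fst Prod.fst

@[simp] theorem vertex_rot (e : LineEnd C B) : vertex (rot e) = vertex e := by
  rcases e with ⟨c, k⟩ | ⟨b, k⟩ <;> rfl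

@[simp] theorem vertex_opp (e : LineEnd C B) : vertex (opp e) = vertex e := by
  rcases e with ⟨c, k⟩ | ⟨b, k⟩ <;> rfl

theorem vertex_surjective : Function.Surjective (vertex : LineEnd C B → C ⊕ B) := by
  rintro (c | b)
  · exact ⟨Sum.inl (c, 0), rfl⟩
  · exact ⟨Sum.inr (b, 0), rfl⟩

theorem natCard [Finite C] [Finite B] :
    Nat.card (LineEnd C B) = 4 * Nat.card C + 2 * Nat.card B := by
  rw [Nat.card_sum, Nat.card_prod, Nat.card_prod, Nat.card_zmod, Nat.card_zmod]
  ring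

instance [Finite C] [Finite B] : Finite (LineEnd C B) :=
  inferInstanceAs (Finite ((C × ZMod 4) ⊕ (B × ZMod 2)))

end LineEnd

/-! ### Counting edges and regions -/

namespace OrientedLinkDiagram

open LineEnd

variable {C B : Type*} (D : OrientedLinkDiagram C B)

theorem natCard_ingoing [Finite C] [Finite B] :
    Nat.card {e // D.ingoing e} = 2 * Nat.card C + Nat.card B := by
  classical
  have h1 : Nat.card (LineEnd C B) =
      Nat.card {e // D.ingoing e} + Nat.card {e // ¬ D.ingoing e} := by
    rw [← Nat.card_sum]
    exact (Nat.card_congr (Equiv.sumCompl _)).symm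
  have h2 : Nat.card {e // D.ingoing e} = Nat.card {e // ¬ D.ingoing e} :=
    Nat.card_congr ⟨fun e => ⟨D.arc e, by rw [D.ingoing_arc, not_not]; exact e.2⟩,
      fun e => ⟨D.arc e, by rw [D.ingoing_arc]; exact e.2⟩,
      fun e => by simp [D.arc_arc], fun e => by simp [D.arc_arc]⟩
  rw [LineEnd.natCard] at h1
  omega

theorem natCard_edge [Finite C] [Finite B] : Nat.card D.Edge = 2 * Nat.card C + Nat.card B := by
  classical
  rw [← D.natCard_ingoing]
  let F : D.Edge → {e // D.ingoing e} :=
    Quot.lift (fun e => if h : D.ingoing e then ⟨e, h⟩ else ⟨D.arc e, (D.ingoing_arc e).2 h⟩) (by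
      rintro e _ rfl
      by_cases h : D.ingoing e <;> simp [h, D.ingoing_arc, D.arc_arc])
  refine Nat.card_congr ⟨F, fun e => Quot.mk _ e.1, ?_, ?_⟩
  · rintro ⟨e⟩
    by_cases h : D.ingoing e
    · simp only [F, h, dif_pos]
      rfl
    · simp only [F, h, dif_neg, not_false_eq_true]
      exact (Quot.sound (r := fun e e' => e' = D.arc e) rfl).symm
  · rintro ⟨e, h⟩
    simp [F, h]

variable {D}

theorem IsConnected.eq_of_invariant (hconn : D.IsConnected) {α : Sort*} {h : LineEnd C B → α}
    (harc : ∀ e, h (D.arc e) = h e) (hrot : ∀ e, h (rot e) = h e) (e e' : LineEnd C B) :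
    h e = h e' := by
  have h1 : (Quot.mk _ e : D.Piece) = Quot.mk _ e' := hconn.2.elim _ _
  exact congrArg (Quot.lift h (by rintro e _ (rfl | rfl) <;> simp [harc, hrot])) h1

theorem IsConnected.nonempty_lineEnd (hconn : D.IsConnected) : Nonempty (LineEnd C B) := by
  obtain ⟨⟨e⟩⟩ := hconn.1
  exact ⟨e⟩

/-- Euler's formula with one piece: bends add equally many vertices and edges, and double points add
twice as many edges as vertices. -/
theorem IsPlanar.natCard_region [Finite C] [Finite B] (hplanar : D.IsPlanar)
    (hconn : D.IsConnected) : Nat.card D.Region = Nat.card C + 2 := by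
  have h1 : Nat.card D.Piece = 1 := Nat.card_eq_one_iff_unique.2 ⟨hconn.2, hconn.1⟩
  rw [IsPlanar, natCard_edge, h1, Nat.card_sum] at hplanar
  push_cast at hplanar
  omega

variable (D)

theorem region_surjective : Function.Surjective D.region := Quot.mk_surjective

theorem region_rotEquiv_symm_arc (e : LineEnd C B) :
    D.region (rotEquiv.symm (D.arc e)) = D.region e :=
  (Quot.sound (r := fun e e' => rot e' = D.arc e) (by simp)).symm

theorem region_rotEquiv_symm (e : LineEnd C B) :
    D.region (rotEquiv.symm e) = D.region (D.arc e) := by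
  rw [← D.region_rotEquiv_symm_arc (D.arc e), D.arc_arc]

/-! ### Mod 2 homology and the checkerboard colouring -/

section Homology

/-- The boundary map modulo two from edges, represented by their ingoing ends, to vertices. -/
noncomputable def boundaryEdge [Fintype {e // D.ingoing e}] :
    ({e // D.ingoing e} → ZMod 2) →ₗ[ZMod 2] (C ⊕ B →₀ ZMod 2) where
  toFun x := ∑ e, x e • (Finsupp.single (vertex e.1) 1 + Finsupp.single (vertex (D.arc e)) 1)
  map_add' x y := by simp only [Pi.add_apply, add_smul, Finset.sum_add_distrib]
  map_smul' r x := by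
    simp only [Pi.smul_apply, smul_eq_mul, mul_smul, Finset.smul_sum, RingHom.id_apply]

/-- The boundary map modulo two from regions to edges. -/
def boundaryRegion : (D.Region → ZMod 2) →ₗ[ZMod 2] ({e // D.ingoing e} → ZMod 2) where
  toFun g e := g (D.region e) + g (D.region (D.arc e))
  map_add' g g' := by ext e; simp only [Pi.add_apply]; ring
  map_smul' r g := by ext e; simp only [Pi.smul_apply, smul_eq_mul, RingHom.id_apply]; ring

variable {D}

theorem sum_ingoing_add_arc [Fintype {e // D.ingoing e}] [Fintype (LineEnd C B)] {M : Type*}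
    [AddCommMonoid M] (h : LineEnd C B → M) :
    ∑ e : {e // D.ingoing e}, (h e + h (D.arc e)) = ∑ e, h e := by
  classical
  rw [Finset.sum_add_distrib, ← Fintype.sum_subtype_add_sum_subtype D.ingoing h]
  refine congrArg₂ (· + ·) 
    (Finset.sum_congr (Finset.ext fun _ => by simp) fun _ _ => rfl) ?_
  let f : {e // D.ingoing e} ≃ {e // ¬ D.ingoing e} :=
    ⟨fun e => ⟨D.arc e, by rw [D.ingoing_arc, not_not]; exact e.2⟩,
      fun e => ⟨D.arc e, by rw [D.ingoing_arc]; exact e.2⟩,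
      fun e => by simp [D.arc_arc], fun e => by simp [D.arc_arc]⟩
  exact Fintype.sum_equiv f _ _ fun _ => rfl

theorem boundaryEdge_apply_of_arc [Fintype {e // D.ingoing e}] [Fintype (LineEnd C B)]
    (y : LineEnd C B → ZMod 2) (hy : ∀ e, y (D.arc e) = y e) :
    D.boundaryEdge (fun e => y e) = ∑ e, y e • Finsupp.single (vertex e) 1 := by
  rw [← sum_ingoing_add_arc (D := D)]
  simp only [boundaryEdge, LinearMap.coe_mk, AddHom.coe_mk, hy, smul_add]

theorem add_self_zmod_two {M : Type*} [AddCommGroup M] [Module (ZMod 2) M] (x : M) :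
    x + x = 0 := by
  rw [← two_smul (ZMod 2) x, show (2 : ZMod 2) = 0 from rfl, zero_smul]

/-- Each corner at a vertex is bordered by two line-ends there, so its value is counted twice;
reindexing by `rotEquiv` matches the two occurrences. -/
theorem boundaryEdge_boundaryRegion [Fintype {e // D.ingoing e}] [Fintype (LineEnd C B)]
    (g : D.Region → ZMod 2) : D.boundaryEdge (D.boundaryRegion g) = 0 := by
  refine (boundaryEdge_apply_of_arc (fun e => g (D.region e) + g (D.region (D.arc e)))
    (fun e => by rw [D.arc_arc, add_comm])).trans ?_
  simp only [add_smul, Finset.sum_add_distrib, ← region_rotEquiv_symm]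
  rw [← Equiv.sum_comp rotEquiv fun e => g (D.region (rotEquiv.symm e)) •
    (Finsupp.single (vertex e) 1 : C ⊕ B →₀ ZMod 2)]
  simp only [rotEquiv_apply, rotEquiv_symm_rot, vertex_rot]
  exact add_self_zmod_two _

/-- Every vertex has even degree: `opp` pairs its line-ends, without fixed points since it reverses
the orientation. -/
theorem boundaryEdge_one [Fintype {e // D.ingoing e}] [Fintype (LineEnd C B)] :
    D.boundaryEdge 1 = 0 := by
  refine (boundaryEdge_apply_of_arc (fun _ => 1) (fun e => rfl)).trans ?_
  refine Finset.sum_involution (fun e _ => opp e) (fun e _ => ?_) (fun e _ _ h => ?_)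
    (fun e _ => Finset.mem_univ _) (fun e _ => opp_opp e)
  · rw [vertex_opp]; exact add_self_zmod_two _
  · have := D.ingoing_opp e
    rw [h] at this
    exact iff_not_self this

/-- A function in the kernel agrees on both sides of every edge, hence is constant by connectedness.
-/
theorem IsConnected.finrank_ker_boundaryRegion_le [Finite C] [Finite B] (hconn : D.IsConnected) :
    Module.finrank (ZMod 2) (LinearMap.ker D.boundaryRegion) ≤ 1 := by
  refine (Submodule.finrank_mono (t := Submodule.span (ZMod 2) {1}) ?_).trans
    ((finrank_span_le_card _).trans (by simp))
  intro g hg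
  have hin : ∀ e, D.ingoing e → g (D.region (D.arc e)) = g (D.region e) := by
    intro e he
    have := congrFun (LinearMap.mem_ker.1 hg) ⟨e, he⟩
    exact (CharTwo.add_eq_zero.1 this).symm
  have harc : ∀ e, g (D.region (D.arc e)) = g (D.region e) := by
    intro e
    by_cases he : D.ingoing e
    · exact hin e he
    · have := hin (D.arc e) ((D.ingoing_arc e).2 he)
      rw [D.arc_arc] at this
      exact this.symm
  have hrot : ∀ e, g (D.region (rot e)) = g (D.region e) := by
    intro e
    rw [← harc (rot e), ← region_rotEquiv_symm, rotEquiv_symm_rot]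
  obtain ⟨e₀⟩ := hconn.nonempty_lineEnd
  refine Submodule.mem_span_singleton.2 ⟨g (D.region e₀), ?_⟩
  ext R
  obtain ⟨e, rfl⟩ := D.region_surjective R
  rw [Pi.smul_apply, Pi.one_apply, smul_eq_mul, mul_one]
  exact hconn.eq_of_invariant (h := fun e => g (D.region e)) harc hrot e₀ e

/-- Modulo boundaries the two ends of an edge coincide, so by connectedness a single vertex spans
the quotient. -/
theorem IsConnected.natCard_le_finrank_range_boundaryEdge_add_one [Finite C] [Finite B]
    [Fintype {e // D.ingoing e}] (hconn : D.IsConnected) :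
    Nat.card (C ⊕ B) ≤ Module.finrank (ZMod 2) (LinearMap.range D.boundaryEdge) + 1 := by
  classical
  obtain ⟨e₀⟩ := hconn.nonempty_lineEnd
  have := Fintype.ofFinite (C ⊕ B)
  set v₀ : C ⊕ B →₀ ZMod 2 := Finsupp.single (vertex e₀) 1 with hv₀
  set Q := LinearMap.range D.boundaryEdge ⊔ Submodule.span (ZMod 2) {v₀} with hQ
  have hin : ∀ e, D.ingoing e → Q.mkQ (Finsupp.single (vertex (D.arc e)) 1) =
      Q.mkQ (Finsupp.single (vertex e) 1) := by
    intro e he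
    rw [Submodule.mkQ_apply, Submodule.mkQ_apply, Submodule.Quotient.eq]
    refine Submodule.mem_sup_left ⟨Pi.single ⟨e, he⟩ 1, ?_⟩
    simp only [boundaryEdge, LinearMap.coe_mk, AddHom.coe_mk]
    rw [Finset.sum_eq_single ⟨e, he⟩ (fun e' _ h => by simp [Pi.single_eq_of_ne h]) (by simp)]
    rw [Pi.single_eq_same, one_smul, eq_sub_iff_add_eq, add_comm, ← add_assoc,
      add_self_zmod_two, zero_add]
  have harc : ∀ e, Q.mkQ (Finsupp.single (vertex (D.arc e)) 1) =
      Q.mkQ (Finsupp.single (vertex e) 1) := by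
    intro e
    by_cases he : D.ingoing e
    · exact hin e he
    · have := hin (D.arc e) ((D.ingoing_arc e).2 he)
      rw [D.arc_arc] at this
      exact this.symm
  have htop : Q = ⊤ := by
    rw [← Submodule.ker_mkQ Q, LinearMap.ker_eq_top]
    refine Finsupp.lhom_ext' fun v => LinearMap.ext_ring ?_
    obtain ⟨e, rfl⟩ := vertex_surjective v
    refine (hconn.eq_of_invariant (h := fun e => Q.mkQ (Finsupp.single (vertex e) 1)) harc
      (fun e => by rw [vertex_rot]) e e₀).trans ?_
    exact (Submodule.Quotient.mk_eq_zero Q).2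
      (Submodule.mem_sup_right (Submodule.mem_span_singleton_self v₀))
  have h1 := Submodule.finrank_add_le_finrank_add_finrank (LinearMap.range D.boundaryEdge)
    (Submodule.span (ZMod 2) {v₀})
  rw [← hQ, htop, finrank_top, Module.finrank_finsupp_self, ← Nat.card_eq_fintype_card] at h1
  exact h1.trans (Nat.add_le_add_left ((finrank_span_le_card _).trans (by simp)) _)

/-- The regions of a connected planar diagram have a checkerboard colouring. -/
theorem IsPlanar.exists_checkerboard [Finite C] [Finite B] (hplanar : D.IsPlanar)
    (hconn : D.IsConnected) :
    ∃ g : D.Region → ZMod 2, ∀ e, g (D.region (D.arc e)) = g (D.region e) + 1 := by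
  classical
  have := Fintype.ofFinite (LineEnd C B)
  have : Finite D.Region := Quot.finite _
  have := Fintype.ofFinite D.Region
  have hle : LinearMap.range D.boundaryRegion ≤ LinearMap.ker D.boundaryEdge := by
    rintro _ ⟨g, rfl⟩
    exact boundaryEdge_boundaryRegion g
  have h1 := LinearMap.finrank_range_add_finrank_ker D.boundaryRegion
  have h2 := LinearMap.finrank_range_add_finrank_ker D.boundaryEdge
  have h3 := hconn.finrank_ker_boundaryRegion_le
  have h4 := hconn.natCard_le_finrank_range_boundaryEdge_add_one
  have h5 := hplanar.natCard_region hconn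
  have h6 := D.natCard_ingoing
  rw [Module.finrank_fintype_fun_eq_card, ← Nat.card_eq_fintype_card] at h1 h2
  rw [Nat.card_sum] at h4
  -- The image has dimension at least `(n + 2) - 1`. With `k` bends, the kernel has dimension at
  -- most `(2n + k) - (n + k - 1)`, the same number.
  have heq := Submodule.eq_of_le_of_finrank_le hle (by omega)
  have hone : (1 : {e // D.ingoing e} → ZMod 2) ∈ LinearMap.range D.boundaryRegion := by
    rw [heq]
    exact boundaryEdge_one
  obtain ⟨g, hg⟩ := hone
  have hin : ∀ e, D.ingoing e → g (D.region (D.arc e)) = g (D.region e) + 1 := by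
    intro e he
    have h : g (D.region e) + g (D.region (D.arc e)) = 1 := congrFun hg ⟨e, he⟩
    rw [← h, ← add_assoc, CharTwo.add_self_eq_zero, zero_add]
  refine ⟨g, fun e => ?_⟩
  by_cases he : D.ingoing e
  · exact hin e he
  · have := hin (D.arc e) ((D.ingoing_arc e).2 he)
    rw [D.arc_arc] at this
    rw [this, add_assoc, CharTwo.add_self_eq_zero, add_zero]

end Homology

end OrientedLinkDiagram

/-! ### Smoothings of the double points -/

namespace LineEnd

variable {C B : Type*}

/-- A labelling of the corners by truth values which alternates around each double point. -/
def IsAlternating (q : LineEnd C B → Prop) : Prop :=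
  ∀ c k, q (Sum.inl (c, k + 1)) ↔ ¬ q (Sum.inl (c, k))

open Classical in
/-- The smoothing of all double points which joins the line-ends `e` and `rot e` whenever
the corner `e` is labelled `True`. -/
noncomputable def smoothing (q : LineEnd C B → Prop) (e : LineEnd C B) : LineEnd C B :=
  if q e then rot e else rotEquiv.symm e

variable {q q' : LineEnd C B → Prop} {c : C} {k : ZMod 4}

theorem smoothing_of_pos {e : LineEnd C B} (h : q e) : smoothing q e = rot e := if_pos h

theorem smoothing_of_neg {e : LineEnd C B} (h : ¬ q e) : smoothing q e = rotEquiv.symm e :=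
  if_neg h

theorem smoothing_inl_of_pos (h : q (Sum.inl (c, k))) :
    smoothing q (Sum.inl (c, k)) = Sum.inl (c, k + 1) := if_pos h

theorem smoothing_inl_of_neg (h : ¬ q (Sum.inl (c, k))) :
    smoothing q (Sum.inl (c, k)) = Sum.inl (c, k - 1) := if_neg h

theorem smoothing_inr (q : LineEnd C B → Prop) (b : B) (k : ZMod 2) :
    smoothing q (Sum.inr (b, k)) = Sum.inr (b, k + 1) := by
  by_cases h : q (Sum.inr (b, k))
  · exact if_pos h
  · rw [smoothing_of_neg h, rotEquiv_symm_inr]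
    rfl

theorem IsAlternating.sub_one (hq : IsAlternating q) :
    q (Sum.inl (c, k - 1)) ↔ ¬ q (Sum.inl (c, k)) := by
  have := hq c (k - 1)
  rw [sub_add_cancel] at this
  rw [this, not_not]

theorem IsAlternating.add_two (hq : IsAlternating q) :
    q (Sum.inl (c, k + 2)) ↔ q (Sum.inl (c, k)) := by
  rw [show k + 2 = k + 1 + 1 by rw [add_assoc]; rfl, hq, hq, not_not]

/-- Both labels flip from one corner to the next, so whether they agree depends only on the double
point. This allows the comparison to be made at the marker. -/
theorem IsAlternating.iff_iff_iff (hq : IsAlternating q) (hq' : IsAlternating q')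
    (c : C) (j k : ZMod 4) : (q (Sum.inl (c, j)) ↔ q' (Sum.inl (c, j))) ↔
      (q (Sum.inl (c, k)) ↔ q' (Sum.inl (c, k))) := by
  have hstep : ∀ k, (q (Sum.inl (c, k + 1)) ↔ q' (Sum.inl (c, k + 1))) ↔
      (q (Sum.inl (c, k)) ↔ q' (Sum.inl (c, k))) := fun k => by
    rw [hq, hq', not_iff_not]
  have hzero : ∀ k, (q (Sum.inl (c, k)) ↔ q' (Sum.inl (c, k))) ↔
      (q (Sum.inl (c, 0)) ↔ q' (Sum.inl (c, 0))) := by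
    intro k
    obtain ⟨n, rfl⟩ := ZMod.natCast_zmod_surjective k
    induction n with
    | zero => rw [Nat.cast_zero]
    | succ n ih => rw [Nat.cast_succ, hstep, ih]
  rw [hzero j, hzero k]

theorem smoothing_smoothing_of_iff (hq : IsAlternating q)
    (h : q (Sum.inl (c, k)) ↔ q' (Sum.inl (c, k))) :
    smoothing q (smoothing q' (Sum.inl (c, k))) = Sum.inl (c, k) := by
  by_cases hk : q' (Sum.inl (c, k))
  · rw [smoothing_inl_of_pos hk, smoothing_inl_of_neg (by rw [hq, not_not]; exact h.2 hk),
      add_sub_cancel_right]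
  · rw [smoothing_inl_of_neg hk, smoothing_inl_of_pos (by rw [hq.sub_one, h]; exact hk),
      sub_add_cancel]

theorem smoothing_smoothing_of_not_iff (hq : IsAlternating q)
    (h : ¬ (q (Sum.inl (c, k)) ↔ q' (Sum.inl (c, k)))) :
    smoothing q (smoothing q' (Sum.inl (c, k))) = Sum.inl (c, k + 2) := by
  by_cases hk : q' (Sum.inl (c, k))
  · have hk' : ¬ q (Sum.inl (c, k)) := by tauto
    rw [smoothing_inl_of_pos hk, smoothing_inl_of_pos (by rwa [hq]), add_assoc]
    rfl
  · have hk' : q (Sum.inl (c, k)) := by tauto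
    rw [smoothing_inl_of_neg hk, smoothing_inl_of_neg (by rw [hq.sub_one, not_not]; exact hk'),
      sub_sub, sub_eq_add_neg]
    rfl

theorem smoothing_smoothing_inr (q q' : LineEnd C B → Prop) (b : B) (k : ZMod 2) :
    smoothing q (smoothing q' (Sum.inr (b, k))) = Sum.inr (b, k) := by
  rw [smoothing_inr, smoothing_inr, add_assoc, show (1 : ZMod 2) + 1 = 0 from rfl, add_zero]

theorem smoothing_involutive (hq : IsAlternating q) (e : LineEnd C B) :
    smoothing q (smoothing q e) = e := by
  rcases e with ⟨c, k⟩ | ⟨b, k⟩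
  · exact smoothing_smoothing_of_iff hq Iff.rfl
  · exact smoothing_smoothing_inr q q b k

theorem smoothing_comm (hq : IsAlternating q) (hq' : IsAlternating q') (e : LineEnd C B) :
    smoothing q (smoothing q' e) = smoothing q' (smoothing q e) := by
  rcases e with ⟨c, k⟩ | ⟨b, k⟩
  · by_cases h : q (Sum.inl (c, k)) ↔ q' (Sum.inl (c, k))
    · rw [smoothing_smoothing_of_iff hq h, smoothing_smoothing_of_iff hq' h.symm]
    · rw [smoothing_smoothing_of_not_iff hq h,
        smoothing_smoothing_of_not_iff hq' fun h' => h h'.symm]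
  · rw [smoothing_smoothing_inr, smoothing_smoothing_inr]

theorem opp_smoothing_comm (hq : IsAlternating q) (e : LineEnd C B) :
    opp (smoothing q e) = smoothing q (opp e) := by
  rcases e with ⟨c, k⟩ | ⟨b, k⟩
  · by_cases h : q (Sum.inl (c, k))
    · rw [smoothing_inl_of_pos h, opp_inl, opp_inl, smoothing_inl_of_pos (hq.add_two.2 h),
        add_right_comm]
    · rw [smoothing_inl_of_neg h, opp_inl, opp_inl,
        smoothing_inl_of_neg (fun h' => h (hq.add_two.1 h')), sub_add_eq_add_sub]
  · rw [smoothing_inr]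
    exact (smoothing_inr _ _ _).symm

theorem smoothing_ne_smoothing_iff (hq : IsAlternating q) (hq' : IsAlternating q')
    (m : C → ZMod 4) (e : LineEnd C B) : smoothing q e ≠ smoothing q' e ↔
      ∃ c, ¬ (q (Sum.inl (c, m c)) ↔ q' (Sum.inl (c, m c))) ∧ ∃ k, e = Sum.inl (c, k) := by
  have hne : ∀ k : ZMod 4, k + 1 ≠ k - 1 := by decide
  rcases e with ⟨c, k⟩ | ⟨b, k⟩
  · trans ¬ (q (Sum.inl (c, k)) ↔ q' (Sum.inl (c, k)))
    · by_cases h : q (Sum.inl (c, k)) <;> by_cases h' : q' (Sum.inl (c, k)) <;>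
        simp [h, h', smoothing_inl_of_pos, smoothing_inl_of_neg, hne, (hne _).symm]
    · rw [hq.iff_iff_iff hq' c k (m c)]
      constructor
      · exact fun h => ⟨c, h, k, rfl⟩
      · rintro ⟨c', h, k', h'⟩
        obtain ⟨rfl, rfl⟩ := Prod.mk.inj (Sum.inl.inj h')
        exact h
  · simp [smoothing_inr]

/-- The conjunct `True` gives the form required by `natCard_subtype_of_iff_exists_inl`, with every
double point selected. -/
theorem opp_ne_smoothing_iff (q : LineEnd C B → Prop) (e : LineEnd C B) :
    opp e ≠ smoothing q e ↔ ∃ c : C, True ∧ ∃ k, e = Sum.inl (c, k) := by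
  have hne : ∀ k : ZMod 4, k + 2 ≠ k + 1 ∧ k + 2 ≠ k - 1 := by decide
  rcases e with ⟨c, k⟩ | ⟨b, k⟩
  · simp only [Sum.inl.injEq, Prod.mk.injEq, true_and, exists_and_left, exists_eq', and_true,
      ne_eq, iff_true]
    rw [opp_inl]
    by_cases h : q (Sum.inl (c, k))
    · simp [smoothing_inl_of_pos h, hne]
    · simp [smoothing_inl_of_neg h, hne]
  · simp [smoothing_inr, opp]

theorem natCard_subtype_of_iff_exists_inl {Q : LineEnd C B → Prop} {K : C → Prop}
    (h : ∀ e, Q e ↔ ∃ c, K c ∧ ∃ k, e = Sum.inl (c, k)) :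
    Nat.card {e // Q e} = 4 * Nat.card {c // K c} := by
  have h1 : Nat.card ({c // K c} × ZMod 4) = 4 * Nat.card {c // K c} := by
    rw [Nat.card_prod, Nat.card_zmod, mul_comm]
  rw [← h1]
  symm
  refine Nat.card_eq_of_bijective
    (fun x => ⟨Sum.inl (x.1.1, x.2), (h _).2 ⟨x.1.1, x.1.2, x.2, rfl⟩⟩) ⟨?_, ?_⟩
  · rintro ⟨⟨c, hc⟩, k⟩ ⟨⟨c', hc'⟩, k'⟩ hx
    obtain ⟨rfl, rfl⟩ := Prod.mk.inj (Sum.inl.inj (Subtype.mk.inj hx))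
    rfl
  · rintro ⟨e, he⟩
    obtain ⟨c, hc, k, rfl⟩ := (h e).1 he
    exact ⟨⟨⟨c, hc⟩, k⟩, rfl⟩

end LineEnd

/-! ### Link components, Seifert circles and black regions -/

namespace OrientedLinkDiagram

open LineEnd

variable {C B : Type*} (D : OrientedLinkDiagram C B)

/-- The corners whose two line-ends are joined by the smoothing that respects the orientation. -/
def orientedCorner (e : LineEnd C B) : Prop := ¬ (D.ingoing (rot e) ↔ D.ingoing e)

theorem isAlternating_orientedCorner : IsAlternating D.orientedCorner := by
  intro c k
  have h := D.ingoing_opp (Sum.inl (c, k))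
  rw [← rot_rot_inl] at h
  simp only [orientedCorner, ← rot_inl, h]
  tauto

theorem ingoing_smoothing_orientedCorner (e : LineEnd C B) :
    D.ingoing (smoothing D.orientedCorner e) ↔ ¬ D.ingoing e := by
  rcases e with ⟨c, k⟩ | ⟨b, k⟩
  · by_cases h : D.orientedCorner (Sum.inl (c, k))
    · rw [smoothing_of_pos h]
      rw [orientedCorner] at h
      tauto
    · rw [smoothing_of_neg h]
      have h' := D.ingoing_opp (rotEquiv.symm (Sum.inl (c, k)))
      rw [opp_rotEquiv_symm_inl] at h'
      rw [orientedCorner] at h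
      tauto
  · rw [smoothing_inr]
    exact D.ingoing_opp (Sum.inr (b, k))

/-- The label here is the orientation, which `opp` and the oriented smoothing both reverse; `opp`
would preserve the colour at double points. The two differ at all four line-ends of every double
point. -/
theorem numComponents_add_natCard_quot_smoothing_modEq [Finite C] [Finite B] :
    D.numComponents +
      Nat.card (Quot fun e e' => e' = D.arc e ∨ e' = smoothing D.orientedCorner e) ≡
      Nat.card C [MOD 2] := by
  have hcard := natCard_subtype_of_iff_exists_inl (opp_ne_smoothing_iff D.orientedCorner)
  rw [Nat.card_congr (Equiv.subtypeUnivEquiv fun _ => trivial)] at hcard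
  exact card_quot_add_card_quot_modEq (smoothing_involutive D.isAlternating_orientedCorner)
    D.ingoing_smoothing_orientedCorner (opp_smoothing_comm D.isAlternating_orientedCorner) hcard
    D.arc_arc opp_opp D.ingoing_arc D.ingoing_opp

theorem zmod_two_add_one_eq_one_iff (x : ZMod 2) : x + 1 = 1 ↔ ¬ x = 1 := by
  revert x; decide

section Checkerboard

variable {D} {g : D.Region → ZMod 2}
  (hg : ∀ e, g (D.region (D.arc e)) = g (D.region e) + 1)
include hg

theorem checkerboard_rot (e : LineEnd C B) :
    g (D.region (rot e)) = 1 ↔ ¬ g (D.region e) = 1 := by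
  have h := D.region_rotEquiv_symm (rot e)
  rw [rotEquiv_symm_rot] at h
  rw [h, hg, zmod_two_add_one_eq_one_iff, not_not]

theorem checkerboard_rotEquiv_symm (e : LineEnd C B) :
    g (D.region (rotEquiv.symm e)) = 1 ↔ ¬ g (D.region e) = 1 := by
  have h := checkerboard_rot hg (rotEquiv.symm e)
  rw [rot_rotEquiv_symm] at h
  rw [h, not_not]

theorem checkerboard_arc (e : LineEnd C B) :
    g (D.region (D.arc e)) = 1 ↔ ¬ g (D.region e) = 1 := by
  rw [hg, zmod_two_add_one_eq_one_iff]

theorem isAlternating_checkerboard : IsAlternating fun e => g (D.region e) = 1 :=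
  fun c k => checkerboard_rot hg (Sum.inl (c, k))

theorem checkerboard_smoothing (q : LineEnd C B → Prop) (e : LineEnd C B) :
    g (D.region (smoothing q e)) = 1 ↔ ¬ g (D.region e) = 1 := by
  by_cases h : q e
  · rw [smoothing_of_pos h, checkerboard_rot hg]
  · rw [smoothing_of_neg h, checkerboard_rotEquiv_symm hg]

/-- Smoothing all double points along the boundaries of the black regions gives one circle
for each black region. -/
theorem natCard_quot_smoothing_checkerboard :
    Nat.card (Quot fun e e' => e' = D.arc e ∨
      e' = smoothing (fun e => g (D.region e) = 1) e) = Nat.card {R // g R = 1} := by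
  classical
  have hq := isAlternating_checkerboard hg
  rw [card_quot_eq_card_orbits_permOfFlip (P := fun e => g (D.region e) = 1) D.arc_arc
    (smoothing_involutive hq) (checkerboard_arc hg) (checkerboard_smoothing hg _)]
  set f := permOfFlip (fun e => g (D.region e) = 1) D.arc _ D.arc_arc
    (smoothing_involutive hq) (checkerboard_arc hg) (checkerboard_smoothing hg _)
  -- The corner at the other end of a black corner's edge is white, so the smoothing turns back by
  -- `rotEquiv.symm`, to the next corner of the same region.
  have hval : ∀ x, (f x : LineEnd C B) = rotEquiv.symm (D.arc x) := fun x =>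
    smoothing_of_neg (q := fun e => g (D.region e) = 1) (e := D.arc x)
      (by rw [checkerboard_arc hg, not_not]; exact x.2)
  let F : (Quot fun x y => y = f x) → {R // g R = 1} :=
    Quot.lift (fun x => ⟨D.region x, x.2⟩) (by
      rintro x _ rfl
      rw [Subtype.mk.injEq, hval, region_rotEquiv_symm_arc])
  -- The inverse of `F` is defined on all regions, with `none` on white ones, so that it can be
  -- lifted from corners.
  let G : D.Region → Option (Quot fun x y => y = f x) :=
    Quot.lift (fun e => if h : g (D.region e) = 1 then some (Quot.mk _ ⟨e, h⟩) else none) (by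
      intro e e' h
      have he : e' = rotEquiv.symm (D.arc e) := by rw [Equiv.eq_symm_apply]; exact h
      subst he
      simp only [region_rotEquiv_symm_arc]
      split_ifs with h1
      · exact congrArg some (Quot.sound (Subtype.ext (hval ⟨e, h1⟩).symm))
      · rfl)
  have hGF : ∀ x, G (F x).1 = some x := by
    rintro ⟨x, hx⟩
    exact dif_pos hx
  refine Nat.card_eq_of_bijective F ⟨fun x y h => ?_, ?_⟩
  · have := hGF x
    rw [h, hGF] at this
    exact (Option.some.inj this).symm
  · rintro ⟨R, hR⟩
    obtain ⟨e, rfl⟩ := D.region_surjective R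
    exact ⟨Quot.mk _ ⟨e, hR⟩, rfl⟩

/-- The label is now the colour, since the checkerboard smoothing need not respect the orientation.
The corners `m` are arbitrary and will be the markers. -/
theorem natCard_quot_smoothing_add_natCard_black_modEq [Finite C] [Finite B] (m : C → ZMod 4) :
    Nat.card (Quot fun e e' => e' = D.arc e ∨ e' = smoothing D.orientedCorner e) +
      Nat.card {R // g R = 1} ≡
      Nat.card {c // ¬ (D.orientedCorner (Sum.inl (c, m c)) ↔
        g (D.region (Sum.inl (c, m c))) = 1)} [MOD 2] := by
  have hq := isAlternating_checkerboard hg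
  have hq' := D.isAlternating_orientedCorner
  rw [← natCard_quot_smoothing_checkerboard hg]
  exact card_quot_add_card_quot_modEq (P := fun e => g (D.region e) = 1)
    (smoothing_involutive hq) (checkerboard_smoothing hg _) (smoothing_comm hq' hq)
    (natCard_subtype_of_iff_exists_inl (smoothing_ne_smoothing_iff hq' hq m))
    D.arc_arc (smoothing_involutive hq') (checkerboard_arc hg) (checkerboard_smoothing hg _)

end Checkerboard

/-! ### Markers, holes and black regions -/

namespace FKTState

variable {D} {R₁ R₂ : D.Region} (S : D.FKTState R₁ R₂)

/-- The holes of a state are the markers in corners which the oriented smoothing does not join. -/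
theorem ncard_blackHoles_add_ncard_whiteHoles [Finite C] :
    S.blackHoles.ncard + S.whiteHoles.ncard =
      Nat.card {c // ¬ D.orientedCorner (Sum.inl (c, S.marker c))} := by
  rw [← Set.ncard_union_eq]
  · rw [← Nat.card_coe_set_eq]
    refine Nat.card_congr (Equiv.subtypeEquivRight fun c => ?_)
    change _ ∧ _ ∨ _ ∧ _ ↔ _
    rw [orientedCorner, rot_inl]
    tauto
  · rw [Set.disjoint_left]
    exact fun c h h' => h'.1 h.1

/-- Each unstarred region of a connected planar diagram has a marker. -/
theorem exists_marker [Finite C] [Finite B] (hplanar : D.IsPlanar) (hconn : D.IsConnected)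
    (hne : R₁ ≠ R₂) {R : D.Region} (h₁ : R ≠ R₁) (h₂ : R ≠ R₂) :
    ∃ c, D.region (Sum.inl (c, S.marker c)) = R := by
  have : Finite D.Region := Quot.finite _
  have hsub : Set.range (fun c => D.region (Sum.inl (c, S.marker c))) ⊆ {R₁, R₂}ᶜ := by
    rintro _ ⟨c, rfl⟩
    simpa using S.unstarred c
  have hcard := Set.ncard_add_ncard_compl ({R₁, R₂} : Set D.Region)
  rw [Set.ncard_pair hne, hplanar.natCard_region hconn] at hcard
  have hrange : (Set.range fun c => D.region (Sum.inl (c, S.marker c))).ncard = Nat.card C := by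
    rw [← Set.image_univ, Set.ncard_image_of_injective _ S.injective, Set.ncard_univ]
  -- `n` distinct marked regions lie among `n + 2 - 2` unstarred ones.
  have heq := Set.eq_of_subset_of_ncard_le hsub (by omega)
  have hR : R ∈ ({R₁, R₂} : Set D.Region)ᶜ := by simp [h₁, h₂]
  rw [← heq] at hR
  exact hR

theorem natCard_black_eq [Finite C] [Finite B] (hplanar : D.IsPlanar) (hconn : D.IsConnected)
    (hne : R₁ ≠ R₂) {g : D.Region → ZMod 2} (hg : g R₁ = 1 ↔ ¬ g R₂ = 1) :
    Nat.card {R // g R = 1} =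
      Nat.card {c // g (D.region (Sum.inl (c, S.marker c))) = 1} + 1 := by
  have : Finite D.Region := Quot.finite _
  -- `R₀` is the black starred region, the only black region without a marker.
  obtain ⟨R₀, hR₀, hother, hmem⟩ : ∃ R₀, g R₀ = 1 ∧ (∀ R, g R = 1 → R ≠ R₀ → R ≠ R₁ ∧ R ≠ R₂) ∧
      (R₀ = R₁ ∨ R₀ = R₂) := by
    by_cases h : g R₁ = 1
    · exact ⟨R₁, h, fun R hR hR' => ⟨hR', fun h' => hg.1 h (h' ▸ hR)⟩, Or.inl rfl⟩
    · exact ⟨R₂, by tauto, fun R hR hR' => ⟨fun h' => h (h' ▸ hR), hR'⟩, Or.inr rfl⟩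
  have hset : {R | g R = 1} = insert R₀ ((fun c => D.region (Sum.inl (c, S.marker c))) ''
      {c | g (D.region (Sum.inl (c, S.marker c))) = 1}) := by
    ext R
    constructor
    · intro hR
      by_cases h : R = R₀
      · exact Or.inl h
      · obtain ⟨c, rfl⟩ := S.exists_marker hplanar hconn hne (hother R hR h).1 (hother R hR h).2
        exact Or.inr ⟨c, hR, rfl⟩
    · rintro (rfl | ⟨c, hc, rfl⟩)
      · exact hR₀
      · exact hc
  have hnot : R₀ ∉ (fun c => D.region (Sum.inl (c, S.marker c))) ''
      {c | g (D.region (Sum.inl (c, S.marker c))) = 1} := by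
    rintro ⟨c, -, hc⟩
    rcases hmem with rfl | rfl
    · exact (S.unstarred c).1 hc
    · exact (S.unstarred c).2 hc
  have h := congrArg Set.ncard hset
  rw [Set.ncard_insert_of_notMem hnot, Set.ncard_image_of_injective _ S.injective] at h
  exact h

end FKTState

end OrientedLinkDiagram

/-! ### Parity at each double point and conclusion -/

/-- Each `c` contributes an even number, as the four truth assignments show. With `p` for "not a
hole" and `q` for "in a black region", this links the holes to the differing smoothings. -/
theorem even_natCard_not_iff_add {α : Type*} [Finite α] (p q : α → Prop) :
    Even (Nat.card {c // ¬ (p c ↔ q c)} + Nat.card {c // ¬ p c} + Nat.card {c // q c} +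
      Nat.card α) := by
  classical
  have := Fintype.ofFinite α
  simp only [Nat.card_eq_fintype_card, Fintype.card_subtype, Finset.card_filter]
  rw [Fintype.card_eq_sum_ones, ← Finset.sum_add_distrib, ← Finset.sum_add_distrib,
    ← Finset.sum_add_distrib]
  refine Finset.even_sum _ fun c _ => ?_
  by_cases hp : p c <;> by_cases hq : q c <;> simp [hp, hq, Nat.even_iff]

open OrientedLinkDiagram in
theorem proposition3 {C B : Type*} [Finite C] [Finite B]
    (D : OrientedLinkDiagram C B) (hplanar : D.IsPlanar) (hconn : D.IsConnected)
    (R₁ R₂ : D.Region) (hadj : D.Adjacent R₁ R₂) (S : D.FKTState R₁ R₂) :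
    (Odd D.numComponents → (Even S.blackHoles.ncard ↔ Even S.whiteHoles.ncard)) ∧
    (Even D.numComponents → (Even S.blackHoles.ncard ↔ Odd S.whiteHoles.ncard)) ∧
    S.blackHoles.ncard + S.whiteHoles.ncard ≡ D.numComponents + 1 [MOD 2] := by
  obtain ⟨g, hg⟩ := hplanar.exists_checkerboard hconn
  obtain ⟨hne, e, h₁, h₂⟩ := hadj
  have hstar : g R₁ = 1 ↔ ¬ g R₂ = 1 := by
    rw [h₁, h₂]
    exact checkerboard_rot hg e
  have hcomp := D.numComponents_add_natCard_quot_smoothing_modEq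
  have hseifert := natCard_quot_smoothing_add_natCard_black_modEq hg S.marker
  have hblack := S.natCard_black_eq hplanar hconn hne hstar
  have hparity := even_natCard_not_iff_add
    (fun c => D.orientedCorner (Sum.inl (c, S.marker c)))
    (fun c => g (D.region (Sum.inl (c, S.marker c))) = 1)
  rw [← S.ncard_blackHoles_add_ncard_whiteHoles] at hparity
  -- The holes number `d + (b - 1) + n ≡ (s + b) + (b - 1) + (μ + s) ≡ μ + 1` modulo two.
  have key : S.blackHoles.ncard + S.whiteHoles.ncard ≡ D.numComponents + 1 [MOD 2] := by
    rw [Nat.even_iff] at hparity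
    rw [Nat.ModEq] at hcomp hseifert ⊢
    omega
  refine ⟨fun h => ?_, fun h => ?_, key⟩ <;> rw [Nat.ModEq] at key
  · rw [Nat.odd_iff] at h
    rw [Nat.even_iff, Nat.even_iff]
    omega
  · rw [Nat.even_iff] at h
    rw [Nat.even_iff, Nat.odd_iff]
    omega
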